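/- In a full binary tree every node is either a leaf or an internal node with a left and a right child; the subtree at a node consists of the node and all its descendants. The compacted form of a full binary tree is the plane DAG obtained by traversing it in post-order and replacing every edge that leads to a subtree already seen during the traversal by a pointer to the first occurrence of this subtree. A compacted tree is a DAG that arises in this way from some full binary tree; its size is its number of internal nodes. Its spine is the binary tree left after deleting all pointers and the leaf, and its right height is the maximal number of right edges on a path from the root to another node of the spine ($0$ if there is no such node). Let $c_{1,n}$ be the number of compacted trees of size $n$ and right height at most $1$, and let $C_1(z)=\sum_{n\ge 0} c_{1,n}\frac{z^n}{n!}$ be their exponential generating function. A power series is called D-finite if it satisfies a nontrivial homogeneous linear differential equation with polynomial coefficients. **Theorem.** The series $C_1$ is D-finite and satisfies $$(1-2z)\,C_1''(z)-(3-z)\,C_1'(z)=0,\qquad C_1(0)=1,\quad C_1'(0)=1.$$ It converges for all complex $z$ with $|z|<\tfrac12$, and there $$C_1'(z)=\frac{e^{z/2}}{(1-2z)^{5/4}},$$ with the principal branch of the power. Moreover, as $n\to\infty$, $$c_{1,n}=\frac{e^{1/4}}{\Gamma(1/4)}\cdot\frac{n!\,2^{n+1}}{n^{3/4}}\left(1+\mathcal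 O\!\left(\frac1n\right)\right).$$ -/

import Mathlib

namespace CompactedTrees

/-- The pictures of binary trees with shared subtrees: a plane binary tree whose terminal positions
are either the unique `leaf` of the DAG or a `pointer i` to the node with unique identifier `i`.
The leaf has identifier `0`, and the internal nodes have the identifiers `1, 2, 3, …` in the order
of the post-order traversal. The identifiers are determined by the shape and are no labels of the
object: a term of this type in which the pointers have valid targets is an unlabelled plane DAG
with its tree edges and its pointers. -/
inductive PointerTree : Type
  | leaf : PointerTree
  | pointer (i : ℕ) : PointerTree
  | node (left right : PointerTree) : PointerTree

/-- The size: the number of internal nodes. -/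
def PointerTree.size : PointerTree → ℕ
  | .leaf => 0
  | .pointer _ => 0
  | .node l r => l.size + r.size + 1

/-- The spine: delete all pointers and the leaf. -/
def PointerTree.spine : PointerTree → BinaryTree Unit
  | .leaf => .nil
  | .pointer _ => .nil
  | .node l r => .node () l.spine r.spine

/-- The maximal number of right edges on a path from the root to another node of a binary tree
whose nodes have a left child or not, and a right child or not (`nil` is a missing child;
the value is `0` if there is no node at all). -/
def rightHeight : BinaryTree Unit → ℕ
  | .nil => 0
  | .node _ l r => max (rightHeight l) (if r = .nil then 0 else rightHeight r + 1)

/-- An entry of the table of subtrees seen so far: `none` is the leaf and `some (i, j)` is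
an internal node whose left and right subtrees have the identifiers `i` and `j`. The identifier of
an entry is its position in the table. -/
abbrev Entry : Type := Option (ℕ × ℕ)

/-- The procedure UID, in post-order. A full binary tree is a `BinaryTree Unit`, where `nil` is
a leaf and every node has two children. Given the table of the subtrees that have been seen so far,
the procedure returns the identifier of the given tree, what is drawn at its place in the compacted
tree (a pointer if this subtree has been seen before), and the updated table. -/
def uid : BinaryTree Unit → List Entry → ℕ × PointerTree × List Entry
  | .nil, T =>
      if none ∈ T then (T.idxOf none, .pointer (T.idxOf none), T)
      else (T.length, .leaf, T ++ [none])
  | .node _ l r, T =>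
      let L := uid l T
      let R := uid r L.2.2
      let e : Entry := some (L.1, R.1)
      if e ∈ R.2.2 then (R.2.2.idxOf e, .pointer (R.2.2.idxOf e), R.2.2)
      else (R.2.2.length, .node L.2.1 R.2.1, R.2.2 ++ [e])

/-- The compacted form of a full binary tree: run the procedure with an empty table. -/
def compact (t : BinaryTree Unit) : PointerTree := (uid t []).2.1

/-- `PointerTree`s which are the compacted form of some full binary tree. -/
def IsCompactedTree (c : PointerTree) : Prop := ∃ t : BinaryTree Unit, compact t = c

/-- The number of compacted binary trees of size `n` and right height at most `k`. -/
noncomputable def numCompacted (k n : ℕ) : ℕ :=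
  {c : PointerTree | IsCompactedTree c ∧ c.size = n ∧ rightHeight c.spine ≤ k}.ncard

/-- The exponential generating function of compacted trees of right height at most `k`. -/
noncomputable def egf (k : ℕ) : PowerSeries ℂ :=
  PowerSeries.mk fun n => (numCompacted k n : ℂ) / (n.factorial : ℂ)

/-- A formal power series is D-finite if it satisfies a nontrivial homogeneous linear differential
equation with polynomial coefficients. -/
def IsDFinite (f : PowerSeries ℂ) : Prop :=
  ∃ (d : ℕ) (p : ℕ → Polynomial ℂ), p d ≠ 0 ∧
    ∑ i ∈ Finset.range (d + 1),
      (p i : PowerSeries ℂ) * (⇑(PowerSeries.derivative ℂ))^[i] f = 0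

end CompactedTrees

/-! A `PointerTree` is compacted exactly when its post-order reading is consistent (`Run`,
`isCompactedTree_iff`): every pointer goes to an earlier entry, and the pair of identifiers of each
internal node is new. Novelty restricts only nodes with two pointers. If a child is an internal node
of the drawing, its identifier is the last one in the table, and no entry refers to it yet.

A tree of right height at most 1 is a root with a left subtree `l` of the same kind and a right
subtree of right height 0, a chain of left edges read over the `s = l.size + 1` entries of `l`. The
bottom node of a nonempty chain has `s² - (s - 1)` choices, and each higher node has one choice of
right pointer per entry then present. Lengthening a chain multiplies the counts by a factor
depending only on the total size, so the convolution `card_trees_succ` collapses to the three-term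
recurrence `numCompacted_one_add_two`, which is the differential equation read coefficientwise.

The coefficients of `exp (x / 2) * (1 - 2 * x) ^ (-5 / 4)` obey the same recurrence, whence the
closed form. The asymptotics need no singularity analysis: in the product of the two series,
monotonicity of `binomCoeff m` and of `binomCoeff m / (m + 1)` bounds the sum on both sides, and
log-convexity of Gamma bounds `binomCoeff`. -/

namespace CompactedTrees

/-! ### Compacted trees as consistent post-order readings -/

/-- `Run T c a T'`: reading `c` in post-order with the table `T` is consistent, the subtree drawn
as `c` has the identifier `a`, and the table afterwards is `T'`. -/
inductive Run : List Entry → PointerTree → ℕ → List Entry → Prop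
  | leaf {T : List Entry} (h : none ∉ T) : Run T .leaf T.length (T ++ [none])
  | pointer {T : List Entry} {i : ℕ} (h : i < T.length) : Run T (.pointer i) i T
  | node {T T₁ T₂ : List Entry} {l r : PointerTree} {a b : ℕ} (hl : Run T l a T₁)
      (hr : Run T₁ r b T₂) (h : some (a, b) ∉ T₂) :
      Run T (.node l r) T₂.length (T₂ ++ [some (a, b)])

/-- Tables without repetitions in which every entry refers to earlier entries only. -/
structure IsTable (T : List Entry) : Prop where
  nodup : T.Nodup
  lt : ∀ k a b : ℕ, T[k]? = some (some (a, b)) → a < k ∧ b < k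

theorem isTable_nil : IsTable [] := ⟨List.nodup_nil, by simp⟩

theorem IsTable.lt_of_mem {T : List Entry} (hT : IsTable T) {a b : ℕ} (h : some (a, b) ∈ T) :
    a + 1 < T.length ∧ b + 1 < T.length := by
  obtain ⟨k, hk, e⟩ := List.getElem_of_mem h
  have := hT.lt k a b (by rw [List.getElem?_eq_getElem hk, e])
  omega

theorem IsTable.append_leaf {T : List Entry} (hT : IsTable T) (h : none ∉ T) :
    IsTable (T ++ [none]) := by
  refine ⟨?_, fun k a b e => ?_⟩
  · rw [List.nodup_append]
    exact ⟨hT.nodup, by simp, fun x hx y hy => by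
      rw [List.mem_singleton] at hy; subst hy; rintro rfl; exact h hx⟩
  · rw [List.getElem?_append] at e
    split_ifs at e with hk
    · exact hT.lt k a b e
    · rw [List.getElem?_singleton] at e
      split_ifs at e
      simp at e

theorem IsTable.append_node {T : List Entry} (hT : IsTable T) {a b : ℕ} (h : some (a, b) ∉ T)
    (ha : a < T.length) (hb : b < T.length) : IsTable (T ++ [some (a, b)]) := by
  refine ⟨?_, fun k a' b' e => ?_⟩
  · rw [List.nodup_append]
    exact ⟨hT.nodup, by simp, fun x hx y hy => by
      rw [List.mem_singleton] at hy; subst hy; rintro rfl; exact h hx⟩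
  · rw [List.getElem?_append] at e
    split_ifs at e with hk
    · exact hT.lt k a' b' e
    · rw [List.getElem?_singleton] at e
      split_ifs at e
      simp only [Option.some.injEq, Prod.mk.injEq] at e
      omega

theorem Run.prefix {T T' : List Entry} {c : PointerTree} {a : ℕ} (h : Run T c a T') :
    T <+: T' := by
  induction h with
  | leaf => exact List.prefix_append _ _
  | pointer => exact List.prefix_rfl
  | node _ _ _ h₁ h₂ => exact (h₁.trans h₂).trans (List.prefix_append _ _)

theorem Run.lt_length {T T' : List Entry} {c : PointerTree} {a : ℕ} (h : Run T c a T') :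
    a < T'.length := by
  cases h with
  | leaf => simp
  | pointer h => exact h
  | node => simp

theorem Run.isTable {T T' : List Entry} {c : PointerTree} {a : ℕ} (h : Run T c a T')
    (hT : IsTable T) : IsTable T' := by
  induction h with
  | leaf h => exact hT.append_leaf h
  | pointer => exact hT
  | node hl hr h h₁ h₂ =>
    exact (h₂ (h₁ hT)).append_node h (hl.lt_length.trans_le hr.prefix.length_le) hr.lt_length

theorem Run.unique {T T' T'' : List Entry} {c : PointerTree} {a a' : ℕ} (h : Run T c a T')
    (h' : Run T c a' T'') : a = a' ∧ T' = T'' := by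
  induction h generalizing a' T'' with
  | leaf => cases h'; exact ⟨rfl, rfl⟩
  | pointer => cases h'; exact ⟨rfl, rfl⟩
  | node hl hr h h₁ h₂ =>
    cases h' with
    | node hl' hr' h' =>
      obtain ⟨rfl, rfl⟩ := h₁ hl'
      obtain ⟨rfl, rfl⟩ := h₂ hr'
      exact ⟨rfl, rfl⟩

theorem Run.eq_or_add_one_eq_length {T T' : List Entry} {c : PointerTree} {a : ℕ}
    (h : Run T c a T') : T' = T ∨ a + 1 = T'.length := by
  cases h with
  | leaf => simp
  | pointer => exact .inl rfl
  | node => simp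

/-- The delicate case is a repeated pair: the procedure then discards the drawings of both children,
and a pointer is a valid reading over `T` only if they left the table unchanged. -/
theorem IsTable.run_uid {T : List Entry} (hT : IsTable T) (t : BinaryTree Unit) :
    Run T (uid t T).2.1 (uid t T).1 (uid t T).2.2 := by
  induction t generalizing T with
  | nil =>
    unfold uid
    split_ifs with h
    · exact .pointer (List.idxOf_lt_length_iff.2 h)
    · exact .leaf h
  | node _ l r hl hr =>
    replace hl := hl hT
    replace hr := hr (hl.isTable hT)
    unfold uid
    dsimp only
    split_ifs with h
    -- An entry refers to strictly earlier positions, whereas a child that enlarged the table would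
    -- have its last position as identifier; so neither child enlarged it.
    · have hlt := ((hr.isTable (hl.isTable hT)).lt_of_mem h)
      have hr' := hr.eq_or_add_one_eq_length.resolve_right (by omega)
      rw [hr'] at hlt
      have hl' := hl.eq_or_add_one_eq_length.resolve_right (by omega)
      have hT' : (uid r (uid l T).2.2).2.2 = T := hr'.trans hl'
      rw [hT'] at h ⊢
      exact .pointer (List.idxOf_lt_length_iff.2 h)
    · exact .node hl hr h

/-- Unfolding the entry `i` recursively gives the full binary tree that a pointer to `i` stands for;
the recursion ends because entries refer backwards. -/
theorem IsTable.exists_uid_eq_pointer {T : List Entry} (hT : IsTable T) (i : ℕ)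
    (hi : i < T.length) : ∃ t, uid t T = (i, .pointer i, T) := by
  induction i using Nat.strong_induction_on with
  | _ i ih =>
    have hidx : T.idxOf T[i] = i := hT.nodup.idxOf_getElem i hi
    have hmem : T[i] ∈ T := List.getElem_mem hi
    rcases e : T[i] with _ | ⟨a, b⟩
    · rw [e] at hidx hmem
      exact ⟨.nil, by simp [uid, hidx, hmem]⟩
    · rw [e] at hidx hmem
      obtain ⟨ha, hb⟩ := hT.lt i a b (by rw [List.getElem?_eq_getElem hi, e])
      obtain ⟨t, ht⟩ := ih a ha (ha.trans hi)
      obtain ⟨u, hu⟩ := ih b hb (hb.trans hi)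
      exact ⟨.node () t u, by simp [uid, ht, hu, hidx, hmem]⟩

theorem Run.exists_uid_eq {T T' : List Entry} {c : PointerTree} {a : ℕ} (h : Run T c a T')
    (hT : IsTable T) : ∃ t, uid t T = (a, c, T') := by
  induction h with
  | leaf h => exact ⟨.nil, by simp [uid, h]⟩
  | pointer h => exact hT.exists_uid_eq_pointer _ h
  | node hl hr h h₁ h₂ =>
    obtain ⟨t, ht⟩ := h₁ hT
    obtain ⟨u, hu⟩ := h₂ (hl.isTable hT)
    exact ⟨.node () t u, by simp [uid, ht, hu, h]⟩

theorem isCompactedTree_iff {c : PointerTree} :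
    IsCompactedTree c ↔ ∃ a T, Run [] c a T := by
  constructor
  · rintro ⟨t, rfl⟩
    exact ⟨_, _, isTable_nil.run_uid t⟩
  · rintro ⟨a, T, h⟩
    obtain ⟨t, ht⟩ := h.exists_uid_eq isTable_nil
    exact ⟨t, by rw [compact, ht]⟩

theorem Run.length_eq {T T' : List Entry} {c : PointerTree} {a : ℕ} (h : Run T c a T')
    (hT : none ∈ T) : T'.length = T.length + c.size := by
  induction h with
  | leaf h => exact absurd hT h
  | pointer => rfl
  | node hl hr h h₁ h₂ =>
    have := h₁ hT
    have := h₂ (hl.prefix.subset hT)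
    simp only [List.length_append, List.length_singleton, PointerTree.size]
    omega

theorem Run.add_one_eq_length {T T' : List Entry} {c : PointerTree} {a : ℕ} (h : Run T c a T')
    (hc : 0 < c.size) : a + 1 = T'.length := by
  cases h with
  | leaf => simp
  | pointer => simp [PointerTree.size] at hc
  | node => simp

/-- Over an empty table no pointer is valid, so the first terminal read is the leaf; from then on
only internal nodes add entries. -/
theorem Run.of_nil {T : List Entry} {c : PointerTree} {a : ℕ} (h : Run [] c a T) :
    none ∈ T ∧ T.length = c.size + 1 ∧ a + 1 = T.length := by
  generalize hS : ([] : List Entry) = S at h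
  induction h with
  | leaf => subst hS; simp [PointerTree.size]
  | pointer h => subst hS; simp at h
  | node hl hr h h₁ h₂ =>
    obtain ⟨h3, h4, h5⟩ := h₁ hS
    have := hr.length_eq h3
    refine ⟨by simp [hr.prefix.subset h3], ?_, by simp⟩
    simp only [List.length_append, List.length_singleton, PointerTree.size]
    omega

/-! ### Enumeration of trees of right height at most one -/

theorem PointerTree.spine_eq_nil_iff {c : PointerTree} : c.spine = .nil ↔ c.size = 0 := by
  cases c <;> simp [spine, size]

theorem PointerTree.rightHeight_node_eq_zero {l r : PointerTree} :
    rightHeight (node l r).spine = 0 ↔ rightHeight l.spine = 0 ∧ r.size = 0 := by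
  rw [spine, rightHeight, ← spine_eq_nil_iff]
  split_ifs with h <;> simp [h]

theorem PointerTree.rightHeight_node_le_one {l r : PointerTree} :
    rightHeight (node l r).spine ≤ 1 ↔ rightHeight l.spine ≤ 1 ∧ rightHeight r.spine = 0 := by
  rw [spine, rightHeight]
  split_ifs with h <;> simp [h, rightHeight]

open Classical in
/-- The trees of size `k` and right height `0` that can be read with a table `T` containing the
leaf. -/
noncomputable def chains (T : List Entry) : ℕ → Finset PointerTree
  | 0 => (Finset.range T.length).image .pointer
  | 1 => ((Finset.range T.length ×ˢ Finset.range T.length).filter fun p => some p ∉ T).image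
      fun p => .node (.pointer p.1) (.pointer p.2)
  | k + 2 => (chains T (k + 1) ×ˢ Finset.range (T.length + (k + 1))).image
      fun p => .node p.1 (.pointer p.2)

theorem exists_run_size_eq_zero {T : List Entry} (hT : none ∈ T) {c : PointerTree} {a : ℕ}
    {T' : List Entry} :
    (Run T c a T' ∧ c.size = 0) ↔ a < T.length ∧ c = .pointer a ∧ T' = T := by
  constructor
  · rintro ⟨h, hc⟩
    cases h with
    | leaf h => exact absurd hT h
    | pointer h => exact ⟨h, rfl, rfl⟩
    | node => simp [PointerTree.size] at hc
  · rintro ⟨h, rfl, rfl⟩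
    exact ⟨.pointer h, rfl⟩

theorem mem_chains {T : List Entry} (hT : IsTable T) (hn : none ∈ T) {k : ℕ} {c : PointerTree} :
    c ∈ chains T k ↔ c.size = k ∧ rightHeight c.spine = 0 ∧ ∃ a T', Run T c a T' := by
  induction k generalizing c with
  | zero =>
    simp only [chains, Finset.mem_image, Finset.mem_range]
    constructor
    · rintro ⟨i, hi, rfl⟩
      exact ⟨rfl, rfl, i, T, .pointer hi⟩
    · rintro ⟨hc, -, a, T', h⟩
      obtain ⟨ha, rfl, -⟩ := (exists_run_size_eq_zero hn).1 ⟨h, hc⟩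
      exact ⟨a, ha, rfl⟩
  | succ k ih =>
    rcases k with _ | k
    · simp only [chains, Finset.mem_image, Finset.mem_filter, Finset.mem_product,
        Finset.mem_range, Prod.exists]
      constructor
      · rintro ⟨a, b, ⟨⟨ha, hb⟩, h⟩, rfl⟩
        exact ⟨rfl, by simp [PointerTree.spine, rightHeight], _, _,
          .node (.pointer ha) (.pointer hb) h⟩
      · rintro ⟨hc, -, a, T', h⟩
        cases h with
        | leaf => simp [PointerTree.size] at hc
        | pointer => simp [PointerTree.size] at hc
        | node hl hr h =>
          simp only [PointerTree.size] at hc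
          obtain ⟨ha, rfl, rfl⟩ := (exists_run_size_eq_zero hn).1 ⟨hl, by omega⟩
          obtain ⟨hb, rfl, rfl⟩ := (exists_run_size_eq_zero hn).1 ⟨hr, by omega⟩
          exact ⟨_, _, ⟨⟨ha, hb⟩, h⟩, rfl⟩
    · simp only [chains, Finset.mem_image, Finset.mem_product, Finset.mem_range, Prod.exists, ih]
      constructor
      · rintro ⟨l, i, ⟨⟨h1, h2, a, T', h⟩, hi⟩, rfl⟩
        have hlen := h.length_eq hn
        refine ⟨by simp [PointerTree.size, h1],
          PointerTree.rightHeight_node_eq_zero.2 ⟨h2, rfl⟩, _, _,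
          .node h (.pointer (by omega)) fun hm => ?_⟩
        -- The left child is an internal node, so its identifier is the last position and the pair
        -- is automatically new: every right pointer is allowed.
        have := ((h.isTable hT).lt_of_mem hm).1
        have := h.add_one_eq_length (by omega)
        omega
      · rintro ⟨hc, hr, a, T', h⟩
        cases h with
        | leaf => simp [PointerTree.size] at hc
        | pointer => simp [PointerTree.size] at hc
        | node hl hr' h =>
          obtain ⟨h1, h2⟩ := PointerTree.rightHeight_node_eq_zero.1 hr
          obtain ⟨hb, rfl, rfl⟩ :=
            (exists_run_size_eq_zero (hl.prefix.subset hn)).1 ⟨hr', h2⟩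
          simp only [PointerTree.size] at hc
          have hlen := hl.length_eq hn
          exact ⟨_, _, ⟨⟨by omega, h1, _, _, hl⟩, by omega⟩, rfl⟩

/-- The number of trees of size `k` and right height `0` over a table with `s` entries. -/
def chainCount (s : ℕ) : ℕ → ℕ
  | 0 => s
  | 1 => s * s - (s - 1)
  | k + 2 => chainCount s (k + 1) * (s + (k + 1))

/-- The forbidden pairs are the entries other than the leaf; they are distinct and their components
lie in range, so exactly `T.length - 1` pairs are lost. -/
theorem IsTable.card_filter_notMem {T : List Entry} (hT : IsTable T) (hn : none ∈ T) :
    ((Finset.range T.length ×ˢ Finset.range T.length).filter fun p => some p ∉ T).card =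
      T.length * T.length - (T.length - 1) := by
  classical
  rw [Finset.filter_not, Finset.card_sdiff_of_subset (Finset.filter_subset _ _),
    Finset.card_product, Finset.card_range]
  congr 1
  have h1 : T.toFinset.card = T.length := List.toFinset_card_of_nodup hT.nodup
  rw [← h1, ← Finset.card_erase_of_mem (List.mem_toFinset.2 hn)]
  refine Finset.card_bij (fun p _ => some p) ?_ ?_ ?_
  · intro p hp
    simpa using (Finset.mem_filter.1 hp).2
  · intro p _ q _ h
    exact Option.some.inj h
  · intro e he
    rw [Finset.mem_erase, List.mem_toFinset] at he
    rcases e with _ | ⟨a, b⟩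
    · exact absurd rfl he.1
    · have := hT.lt_of_mem he.2
      refine ⟨(a, b), ?_, rfl⟩
      rw [h1]
      simp only [Finset.mem_filter, Finset.mem_product, Finset.mem_range]
      exact ⟨⟨by omega, by omega⟩, he.2⟩

open Classical in
theorem card_chains {T : List Entry} (hT : IsTable T) (hn : none ∈ T) (k : ℕ) :
    (chains T k).card = chainCount T.length k := by
  induction k with
  | zero =>
    rw [chains, chainCount, Finset.card_image_of_injective _ fun i j h => by simpa using h,
      Finset.card_range]
  | succ k ih =>
    rcases k with _ | k
    · rw [chains, chainCount, Finset.card_image_of_injective _ fun p q h => by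
        simpa [Prod.ext_iff] using h]
      convert! hT.card_filter_notMem hn
    · rw [chains, chainCount, Finset.card_image_of_injective _ fun p q h => by
        simpa [Prod.ext_iff] using h, Finset.card_product, Finset.card_range, ih]

open Classical in
/-- The table after reading a compacted tree. -/
noncomputable def table (c : PointerTree) : List Entry :=
  if h : ∃ a T, Run [] c a T then h.choose_spec.choose else []

theorem Run.table_eq {c : PointerTree} {a : ℕ} {T : List Entry} (h : Run [] c a T) :
    table c = T := by
  have h' : ∃ a T, Run [] c a T := ⟨a, T, h⟩
  rw [table, dif_pos h']
  exact (h'.choose_spec.choose_spec.unique h).2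

open Classical in
/-- The compacted trees of size `n` and right height at most `1`. -/
noncomputable def trees : ℕ → Finset PointerTree
  | 0 => {.leaf}
  | n + 1 => (Finset.univ : Finset (Fin (n + 1))).biUnion fun i =>
      (trees i).biUnion fun l => (chains (table l) (n - i)).image (.node l)

theorem mem_trees {n : ℕ} {c : PointerTree} :
    c ∈ trees n ↔ c.size = n ∧ rightHeight c.spine ≤ 1 ∧ ∃ a T, Run [] c a T := by
  induction n using Nat.strong_induction_on generalizing c with
  | _ n ih =>
    rcases n with _ | n
    · rw [trees, Finset.mem_singleton]
      constructor
      · rintro rfl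
        exact ⟨rfl, by simp [PointerTree.spine, rightHeight], _, _, .leaf (by simp)⟩
      · rintro ⟨hc, -, a, T, h⟩
        cases h with
        | leaf => rfl
        | pointer h => simp at h
        | node => simp [PointerTree.size] at hc
    · rw [trees]
      simp only [Finset.mem_biUnion, Finset.mem_univ, true_and, Finset.mem_image]
      constructor
      · rintro ⟨i, l, hl, r, hr, rfl⟩
        obtain ⟨h1, h2, a, T, h⟩ := (ih i i.2).1 hl
        obtain ⟨h3, h4, h5⟩ := h.of_nil
        have hT := h.isTable isTable_nil
        rw [h.table_eq] at hr
        obtain ⟨h6, h7, b, T', h'⟩ := (mem_chains hT h3).1 hr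
        have hi := i.2
        refine ⟨by simp only [PointerTree.size]; omega,
          PointerTree.rightHeight_node_le_one.2 ⟨h2, h7⟩, _, _, .node h h' fun hm => ?_⟩
        have := (h'.isTable hT).lt_of_mem hm
        -- The pair at the root is always new: it contains the last identifier, that of `r` if `r`
        -- has internal nodes and that of `l` otherwise.
        rcases Nat.eq_zero_or_pos r.size with h0 | h0
        · obtain ⟨-, -, rfl⟩ := (exists_run_size_eq_zero h3).1 ⟨h', h0⟩
          omega
        · have := h'.add_one_eq_length h0
          omega
      · rintro ⟨hc, hr, a, T, h⟩
        cases h with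
        | leaf => simp [PointerTree.size] at hc
        | pointer h => simp at h
        | @node _ _ _ l r _ _ hl hr' h =>
          obtain ⟨h1, h2⟩ := PointerTree.rightHeight_node_le_one.1 hr
          simp only [PointerTree.size] at hc
          refine ⟨⟨l.size, by omega⟩, l, (ih _ (by simp; omega)).2 ⟨rfl, h1, _, _, hl⟩, r, ?_, rfl⟩
          rw [hl.table_eq, mem_chains (hl.isTable isTable_nil) hl.of_nil.1]
          exact ⟨by simp; omega, h2, _, _, hr'⟩

theorem card_trees_succ (n : ℕ) :
    (trees (n + 1)).card =
      ∑ i ∈ Finset.range (n + 1), (trees i).card * chainCount (i + 1) (n - i) := by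
  classical
  rw [trees, Finset.card_biUnion, Finset.sum_range]
  · refine Finset.sum_congr rfl fun i _ => ?_
    rw [Finset.card_biUnion]
    · rw [Finset.card_eq_sum_ones (trees i), Finset.sum_mul, one_mul]
      refine Finset.sum_congr rfl fun l hl => ?_
      obtain ⟨h1, -, a, T, h⟩ := mem_trees.1 hl
      obtain ⟨h3, h4, -⟩ := h.of_nil
      rw [Finset.card_image_of_injective _ fun r r' h => by simpa using h, h.table_eq,
        card_chains (h.isTable isTable_nil) h3, h4, h1]
    · intro l _ l' _ hne
      simp only [Function.onFun, Finset.disjoint_left, Finset.mem_image]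
      rintro c ⟨r, -, rfl⟩ ⟨r', -, e⟩
      injection e with e1
      exact hne e1.symm
  · intro i _ j _ hne
    simp only [Function.onFun, Finset.disjoint_left, Finset.mem_biUnion, Finset.mem_image]
    rintro c ⟨l, hl, r, -, rfl⟩ ⟨l', hl', r', -, e⟩
    injection e with e1
    subst e1
    exact hne (Fin.ext ((mem_trees.1 hl).1.symm.trans (mem_trees.1 hl').1))

theorem numCompacted_one_eq (n : ℕ) : numCompacted 1 n = (trees n).card := by
  rw [numCompacted, ← Set.ncard_coe_finset]
  congr 1
  ext c
  rw [Finset.mem_coe, mem_trees, Set.mem_ofPred_eq, isCompactedTree_iff]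
  tauto

theorem numCompacted_one_zero : numCompacted 1 0 = 1 := by
  rw [numCompacted_one_eq, trees, Finset.card_singleton]

theorem numCompacted_one_one : numCompacted 1 1 = 1 := by
  rw [numCompacted_one_eq, card_trees_succ]
  simp [chainCount, trees]

theorem numCompacted_one_add_two (n : ℕ) :
    numCompacted 1 (n + 2) + n * numCompacted 1 n = (2 * n + 3) * numCompacted 1 (n + 1) := by
  simp only [numCompacted_one_eq]
  set c : ℕ → ℕ := fun n => (trees n).card
  -- `S n` counts the trees of size `n + 1` whose right subtree is not a mere pointer.
  let S : ℕ → ℕ := fun n => ∑ i ∈ Finset.range n, c i * chainCount (i + 1) (n - i)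
  have hc : ∀ n, c (n + 1) = (n + 1) * c n + S n := fun n => by
    simp only [c, S]
    rw [card_trees_succ, Finset.sum_range_succ, Nat.sub_self, chainCount]
    ring
  have hS : S (n + 1) = (n + 1) * S n + c n * ((n + 1) * (n + 1) - n) := by
    simp only [S]
    rw [Finset.sum_range_succ, show n + 1 - n = 1 by omega, chainCount, Finset.mul_sum,
      Nat.add_sub_cancel]
    congr 1
    refine Finset.sum_congr rfl fun i hi => ?_
    have hi := Finset.mem_range.1 hi
    -- The new chain node contributes `(i + 1) + (n - i) = n + 2 - 1` choices, independent of `i`;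
    -- this is why `S` satisfies a first-order recurrence.
    obtain ⟨k, rfl⟩ : ∃ k, n = i + k + 1 := ⟨n - i - 1, by omega⟩
    rw [show i + k + 1 + 1 - i = k + 2 by omega, show i + k + 1 - i = k + 1 by omega, chainCount]
    ring
  have h1 := hc n
  have h2 := hc (n + 1)
  change c (n + 2) + n * c n = (2 * n + 3) * c (n + 1)
  obtain ⟨d, hd⟩ : ∃ d, (n + 1) * (n + 1) - n = d := ⟨_, rfl⟩
  have hd' : d + n = (n + 1) * (n + 1) := by
    have : n ≤ (n + 1) * (n + 1) := by nlinarith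
    omega
  rw [hd] at hS
  rw [h2, hS]
  zify at *
  linear_combination (-(n : ℤ) - 1) * h1 + (c n : ℤ) * hd'

end CompactedTrees

/-! ### Coefficients of the closed form and bounds on Gamma -/

namespace CompactedTrees

open Nat in
/-- The coefficients of `(1 - x) ^ (-5 / 4)`. -/
noncomputable def binomCoeff (m : ℕ) : ℝ := Real.Gamma (m + 5 / 4) / (Real.Gamma (5 / 4) * m !)

theorem Gamma_five_fourths_pos : 0 < Real.Gamma (5 / 4) := Real.Gamma_pos_of_pos (by norm_num)

theorem binomCoeff_pos (m : ℕ) : 0 < binomCoeff m :=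
  div_pos (Real.Gamma_pos_of_pos (by positivity)) (mul_pos Gamma_five_fourths_pos (by positivity))

theorem binomCoeff_zero : binomCoeff 0 = 1 := by
  have := Gamma_five_fourths_pos
  simp [binomCoeff, this.ne']

theorem binomCoeff_succ (m : ℕ) : (m + 1) * binomCoeff (m + 1) = (m + 5 / 4) * binomCoeff m := by
  have := Gamma_five_fourths_pos
  rw [binomCoeff, binomCoeff, Nat.factorial_succ, Nat.cast_mul,
    show ((m + 1 : ℕ) : ℝ) + 5 / 4 = (m + 5 / 4) + 1 by push_cast; ring,
    Real.Gamma_add_one (by positivity)]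
  push_cast
  field_simp

theorem binomCoeff_le_succ (m : ℕ) : binomCoeff m ≤ binomCoeff (m + 1) := by
  have h := binomCoeff_succ m
  have := binomCoeff_pos m
  have hm : (0 : ℝ) < m + 1 := by positivity
  nlinarith

theorem binomCoeff_monotone : Monotone binomCoeff := monotone_nat_of_le_succ binomCoeff_le_succ

theorem binomCoeff_div_antitone : Antitone fun m : ℕ => binomCoeff m / (m + 1) := by
  refine antitone_nat_of_succ_le fun m => ?_
  have h := binomCoeff_succ m
  have := binomCoeff_pos m
  rw [div_le_div_iff₀ (by positivity) (by positivity), mul_comm _ ((m : ℝ) + 1), h]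
  push_cast
  nlinarith

/-- Log-convexity of Gamma, as in Bohr–Mollerup, at the integer `m + 1` with increment `1 / 4`. -/
theorem Gamma_nat_add_le (m : ℕ) :
    Real.Gamma (m + 5 / 4) ≤ ((m : ℝ) + 1) ^ (1 / 4 : ℝ) * m.factorial := by
  have hg : 0 < Real.Gamma (m + 5 / 4) := Real.Gamma_pos_of_pos (by positivity)
  have hfeq : ∀ {y : ℝ}, 0 < y →
      (Real.log ∘ Real.Gamma) (y + 1) = (Real.log ∘ Real.Gamma) y + Real.log y := fun {y} hy => by
    simp only [Function.comp_apply]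
    rw [Real.Gamma_add_one hy.ne', Real.log_mul hy.ne' (Real.Gamma_pos_of_pos hy).ne', add_comm]
  have h := Real.BohrMollerup.f_add_nat_le Real.convexOn_log_Gamma hfeq (n := m + 1) (x := 1 / 4)
    (by simp) (by norm_num) (by norm_num)
  simp only [Function.comp_apply] at h
  push_cast at h
  rw [Real.Gamma_nat_eq_factorial, show (m : ℝ) + 1 + 1 / 4 = m + 5 / 4 by ring,
    ← Real.log_rpow (by positivity), ← Real.log_mul (by positivity) (by positivity)] at h
  rw [mul_comm]
  exact (Real.log_le_log_iff hg (by positivity)).1 h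

theorem le_Gamma_nat_add (m : ℕ) :
    (m : ℝ) ^ (1 / 4 : ℝ) * m.factorial ≤ Real.Gamma (m + 5 / 4) := by
  have hg : 0 < Real.Gamma (m + 5 / 4) := Real.Gamma_pos_of_pos (by positivity)
  -- The lower convexity bound involves `log m`, so `m = 0` is separate; there the left side
  -- vanishes.
  rcases Nat.eq_zero_or_pos m with rfl | hm
  · rw [Nat.cast_zero, Real.zero_rpow (by norm_num), zero_mul]
    simpa using hg.le
  have hfeq : ∀ {y : ℝ}, 0 < y →
      (Real.log ∘ Real.Gamma) (y + 1) = (Real.log ∘ Real.Gamma) y + Real.log y := fun {y} hy => by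
    simp only [Function.comp_apply]
    rw [Real.Gamma_add_one hy.ne', Real.log_mul hy.ne' (Real.Gamma_pos_of_pos hy).ne', add_comm]
  have h := Real.BohrMollerup.f_add_nat_ge Real.convexOn_log_Gamma hfeq (n := m + 1) (x := 1 / 4)
    (by omega) (by norm_num)
  simp only [Function.comp_apply] at h
  push_cast at h
  have hm' : (0 : ℝ) < m := by exact_mod_cast hm
  rw [Real.Gamma_nat_eq_factorial, show (m : ℝ) + 1 + 1 / 4 = m + 5 / 4 by ring,
    add_sub_cancel_right,
    ← Real.log_rpow (by positivity), ← Real.log_mul (by positivity) (by positivity)] at h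
  rw [mul_comm]
  exact (Real.log_le_log_iff (by positivity) hg).1 h

/-- The coefficients of `exp (x / 2) * (1 - 2 * x) ^ (-5 / 4)`. -/
noncomputable def derivCoeff (n : ℕ) : ℝ :=
  ∑ p ∈ Finset.HasAntidiagonal.antidiagonal n,
    ((1 / 2) ^ p.1 / (p.1.factorial : ℝ)) * (2 ^ p.2 * binomCoeff p.2)

open PowerSeries in
-- The factors satisfy `E' = E / 2` and `(1 - 2X) B' = (5 / 2) B`, and `(1 - 2X) / 2 + 5 / 2 = 3 -
-- X`.
theorem mk_derivCoeff_ode :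
    d⁄dX ℝ (mk derivCoeff) =
      X * (C 2 * d⁄dX ℝ (mk derivCoeff)) + C 3 * mk derivCoeff - X * mk derivCoeff := by
  set E : PowerSeries ℝ := mk fun n => (1 / 2) ^ n / (n.factorial : ℝ) with hE
  set B : PowerSeries ℝ := mk fun n => 2 ^ n * binomCoeff n with hB
  have hY : (mk derivCoeff : PowerSeries ℝ) = E * B := by
    ext n
    simp [coeff_mul, hE, hB, derivCoeff]
  have hE' : d⁄dX ℝ E = C (1 / 2) * E := by
    ext n
    rw [coeff_derivative, coeff_C_mul, hE, coeff_mk, coeff_mk, Nat.factorial_succ, pow_succ]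
    push_cast
    field_simp
  have hB' : d⁄dX ℝ B = X * (C 2 * d⁄dX ℝ B) + C (5 / 2) * B := by
    ext n
    rcases n with _ | n
    · have := binomCoeff_succ 0
      simp only [Nat.cast_zero] at this
      simp [coeff_derivative, hB]
      linarith
    · have := binomCoeff_succ (n + 1)
      rw [map_add, coeff_succ_X_mul, coeff_C_mul, coeff_C_mul, coeff_derivative, coeff_derivative,
        hB, coeff_mk, coeff_mk]
      push_cast at this ⊢
      rw [pow_succ _ (n + 1)]
      linear_combination (2 ^ (n + 1) * 2) * this
  rw [hY, Derivation.leibniz, hE', smul_eq_mul, smul_eq_mul]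
  have h2 : (C 2 : PowerSeries ℝ) = 2 := rfl
  have h3 : (C 3 : PowerSeries ℝ) = 3 := rfl
  have h4 : (2 : PowerSeries ℝ) * C (1 / 2) = 1 := by
    rw [← h2, ← map_mul]; norm_num
  have h5 : (C (5 / 2) : PowerSeries ℝ) = 5 * C (1 / 2) := by
    rw [show (5 : PowerSeries ℝ) = C 5 from rfl, ← map_mul]; norm_num
  rw [h2, h5] at hB'
  rw [h2, h3]
  linear_combination E * hB' + (3 - X) * E * B * h4

theorem derivCoeff_zero : derivCoeff 0 = 1 := by
  simp [derivCoeff, binomCoeff_zero]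

theorem derivCoeff_one : derivCoeff 1 = 3 := by
  have := congrArg (PowerSeries.coeff 0) mk_derivCoeff_ode
  simpa [PowerSeries.coeff_derivative, derivCoeff_zero] using this

theorem derivCoeff_add_two (n : ℕ) :
    (n + 2) * derivCoeff (n + 2) = (2 * (n + 1) + 3) * derivCoeff (n + 1) - derivCoeff n := by
  have := congrArg (PowerSeries.coeff (n + 1)) mk_derivCoeff_ode
  rw [map_sub, map_add, PowerSeries.coeff_succ_X_mul, PowerSeries.coeff_succ_X_mul,
    PowerSeries.coeff_C_mul, PowerSeries.coeff_C_mul, PowerSeries.coeff_derivative,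
    PowerSeries.coeff_derivative, PowerSeries.coeff_mk, PowerSeries.coeff_mk,
    PowerSeries.coeff_mk] at this
  push_cast at this
  linear_combination this

/-! ### The differential equation and D-finiteness -/

theorem numCompacted_one_succ (n : ℕ) :
    (numCompacted 1 (n + 1) : ℝ) = n.factorial * derivCoeff n := by
  induction n using Nat.twoStepInduction with
  | zero => simp [numCompacted_one_one, derivCoeff_zero]
  | one =>
    have := numCompacted_one_add_two 0
    rw [zero_mul, add_zero, numCompacted_one_one] at this
    rw [this, derivCoeff_one]
    norm_num
  | more n h₀ h₁ =>
    have h : (numCompacted 1 (n + 1 + 2) : ℝ) + (n + 1) * numCompacted 1 (n + 1) =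
        (2 * (n + 1) + 3) * numCompacted 1 (n + 1 + 1) := by
      exact_mod_cast numCompacted_one_add_two (n + 1)
    have hd := derivCoeff_add_two n
    rw [h₀, h₁] at h
    rw [show n + 2 + 1 = n + 1 + 2 from rfl, Nat.factorial_succ (n + 1)]
    rw [Nat.factorial_succ] at h ⊢
    push_cast at h ⊢
    linear_combination h - (n + 1) * (n.factorial : ℝ) * hd

theorem numCompacted_one_succ_complex (n : ℕ) :
    (numCompacted 1 (n + 1) : ℂ) = n.factorial * (derivCoeff n : ℂ) := by
  exact_mod_cast congrArg Complex.ofReal (numCompacted_one_succ n)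

open PowerSeries in
theorem coeff_derivative_egf_one (n : ℕ) :
    coeff n (derivative ℂ (egf 1)) = numCompacted 1 (n + 1) / (n.factorial : ℂ) := by
  rw [coeff_derivative, egf, coeff_mk, Nat.factorial_succ]
  have : (n : ℂ) + 1 ≠ 0 := by exact_mod_cast Nat.succ_ne_zero n
  push_cast
  field_simp

open PowerSeries in
theorem egf_one_ode :
    (1 - 2 * X) * derivative ℂ (derivative ℂ (egf 1)) - (3 - X) * derivative ℂ (egf 1) = 0 := by
  have key : derivative ℂ (derivative ℂ (egf 1)) - X * (C 2 * derivative ℂ (derivative ℂ (egf 1)))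
      - C 3 * derivative ℂ (egf 1) + X * derivative ℂ (egf 1) = 0 := by
    ext n
    rcases n with _ | n
    · have := numCompacted_one_add_two 0
      rw [zero_mul, add_zero, numCompacted_one_one] at this
      rw [map_add, map_sub, map_sub, coeff_zero_X_mul, coeff_zero_X_mul, coeff_C_mul,
        coeff_derivative, coeff_derivative_egf_one, coeff_derivative_egf_one, this,
        numCompacted_one_one]
      norm_num
    · have h : (numCompacted 1 (n + 1 + 2) : ℂ) + (n + 1) * numCompacted 1 (n + 1) =
          (2 * (n + 1) + 3) * numCompacted 1 (n + 1 + 1) := by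
        exact_mod_cast numCompacted_one_add_two (n + 1)
      rw [map_add, map_sub, map_sub, coeff_succ_X_mul, coeff_succ_X_mul, coeff_C_mul, coeff_C_mul,
        coeff_derivative (derivative ℂ (egf 1)), coeff_derivative (derivative ℂ (egf 1)),
        coeff_derivative_egf_one, coeff_derivative_egf_one, coeff_derivative_egf_one, map_zero, Nat.factorial_succ (n + 1), Nat.factorial_succ n,
        show n + 1 + 1 + 1 = n + 1 + 2 from rfl]
      have h1 : (n : ℂ) + 1 ≠ 0 := by exact_mod_cast Nat.succ_ne_zero n
      have h2 : (n : ℂ) + 1 + 1 ≠ 0 := by exact_mod_cast Nat.succ_ne_zero (n + 1)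
      have h3 : (n.factorial : ℂ) ≠ 0 := by exact_mod_cast n.factorial_ne_zero
      push_cast at h ⊢
      field_simp
      linear_combination h
  rw [show (C 2 : PowerSeries ℂ) = 2 from rfl, show (C 3 : PowerSeries ℂ) = 3 from rfl] at key
  linear_combination key

theorem isDFinite_egf_one : IsDFinite (egf 1) := by
  refine ⟨2, fun i => if i = 0 then 0 else if i = 1 then Polynomial.X - Polynomial.C 3 else
    1 - Polynomial.C 2 * Polynomial.X, fun h => ?_, ?_⟩
  · have := congrArg (Polynomial.eval 0) h
    simp at this
  · have := egf_one_ode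
    simp only [Finset.sum_range_succ, Finset.sum_range_zero]
    simp only [Function.iterate_succ, Function.iterate_zero, Function.comp_apply, id]
    simp only [if_true, one_ne_zero, if_false, OfNat.ofNat_ne_zero, OfNat.ofNat_ne_one,
      Polynomial.coe_zero, Polynomial.coe_sub, Polynomial.coe_X, Polynomial.coe_C,
      Polynomial.coe_one, Polynomial.coe_mul]
    rw [show (PowerSeries.C 2 : PowerSeries ℂ) = 2 from rfl,
      show (PowerSeries.C 3 : PowerSeries ℂ) = 3 from rfl]
    linear_combination this

theorem constantCoeff_egf_one : PowerSeries.constantCoeff (egf 1) = 1 := by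
  rw [← PowerSeries.coeff_zero_eq_constantCoeff_apply, egf, PowerSeries.coeff_mk,
    numCompacted_one_zero]
  simp

theorem constantCoeff_derivative_egf_one :
    PowerSeries.constantCoeff (PowerSeries.derivative ℂ (egf 1)) = 1 := by
  rw [← PowerSeries.coeff_zero_eq_constantCoeff_apply, coeff_derivative_egf_one,
    numCompacted_one_one]
  simp

/-! ### Convergence and the closed form of the derivative -/

/-- Multiplied by `n!`, both sides are the rising factorial of `5 / 4`. -/
theorem choose_eq_binomCoeff (n : ℕ) :
    Ring.choose ((5 / 4 : ℂ) + n - 1) n = (binomCoeff n : ℂ) := by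
  have h : ∀ n : ℕ, (ascPochhammer ℂ n).eval (5 / 4 : ℂ) = n.factorial * (binomCoeff n : ℂ) := by
    intro n
    induction n with
    | zero => simp [binomCoeff_zero]
    | succ n ih =>
      have hs : ((n : ℂ) + 1) * binomCoeff (n + 1) = (n + 5 / 4) * binomCoeff n := by
        have := congrArg Complex.ofReal (binomCoeff_succ n)
        push_cast at this
        exact this
      rw [ascPochhammer_succ_eval, ih, Nat.factorial_succ]
      push_cast
      linear_combination -(n.factorial : ℂ) * hs
  have h3 : (n.factorial : ℂ) ≠ 0 := by exact_mod_cast n.factorial_ne_zero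
  rw [← Ring.multichoose_eq]
  have h2 := Ring.factorial_nsmul_multichoose_eq_ascPochhammer (5 / 4 : ℂ) n
  rw [Polynomial.ascPochhammer_smeval_eq_eval, h n, nsmul_eq_mul] at h2
  exact mul_left_cancel₀ h3 h2

theorem hasSum_binomCoeff {z : ℂ} (hz : ‖z‖ < 1) :
    Summable (fun n : ℕ => ‖(binomCoeff n : ℂ) * z ^ n‖) ∧
      HasSum (fun n : ℕ => (binomCoeff n : ℂ) * z ^ n) (1 / (1 - z) ^ (5 / 4 : ℂ)) := by
  have h := Complex.one_div_one_sub_cpow_hasFPowerSeriesOnBall_zero (5 / 4)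
  have hz' : z ∈ Metric.eball (0 : ℂ) 1 := by
    rw [← ENNReal.ofReal_one, Metric.eball_ofReal]
    simpa using hz
  have e : ∀ n : ℕ, (FormalMultilinearSeries.ofScalars ℂ
      (fun n : ℕ => Ring.choose ((5 / 4 : ℂ) + n - 1) n)) n (fun _ => z) =
      (binomCoeff n : ℂ) * z ^ n := fun n => by
    rw [FormalMultilinearSeries.ofScalars_apply_eq, choose_eq_binomCoeff, smul_eq_mul]
  have h1 := FormalMultilinearSeries.summable_norm_apply _ (Metric.eball_subset_eball h.r_le hz')
  have h2 := h.hasSum hz'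
  simp only [e, zero_add] at h1 h2
  exact ⟨h1, h2⟩

theorem hasSum_derivCoeff {z : ℂ} (hz : ‖z‖ < 1 / 2) :
    Summable (fun n : ℕ => ‖(derivCoeff n : ℂ) * z ^ n‖) ∧
      HasSum (fun n : ℕ => (derivCoeff n : ℂ) * z ^ n)
        (Complex.exp (z / 2) / (1 - 2 * z) ^ (5 / 4 : ℂ)) := by
  have hz2 : ‖2 * z‖ < 1 := by rw [norm_mul, Complex.norm_ofNat]; linarith
  obtain ⟨h1, h2⟩ := hasSum_binomCoeff hz2
  have h3 : Summable (fun n : ℕ => ‖(z / 2) ^ n / (n.factorial : ℂ)‖) :=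
    NormedSpace.norm_expSeries_div_summable (𝔸 := ℂ) (z / 2)
  have h4 : HasSum (fun n : ℕ => (z / 2) ^ n / (n.factorial : ℂ)) (Complex.exp (z / 2)) := by
    rw [Complex.exp_eq_exp_ℂ]
    exact NormedSpace.expSeries_div_hasSum_exp (z / 2)
  have e : (fun n : ℕ => ∑ p ∈ Finset.HasAntidiagonal.antidiagonal n,
      ((z / 2) ^ p.1 / (p.1.factorial : ℂ)) * ((binomCoeff p.2 : ℂ) * (2 * z) ^ p.2)) =
      fun n : ℕ => (derivCoeff n : ℂ) * z ^ n := by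
    funext n
    rw [derivCoeff, Complex.ofReal_sum, Finset.sum_mul]
    refine Finset.sum_congr rfl fun p hp => ?_
    rw [← Finset.HasAntidiagonal.mem_antidiagonal.1 hp]
    push_cast
    rw [pow_add, mul_pow, div_pow, div_pow]
    ring
  have h5 := summable_norm_sum_mul_antidiagonal_of_summable_norm h3 h1
  have h6 := tsum_mul_tsum_eq_tsum_sum_antidiagonal_of_summable_norm h3 h1
  rw [h4.tsum_eq, h2.tsum_eq] at h6
  rw [e, mul_one_div] at h6
  have h5' : Summable (fun n : ℕ => ‖(derivCoeff n : ℂ) * z ^ n‖) := by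
    simpa only [congrFun e] using h5
  exact ⟨h5', h6 ▸ h5'.of_norm.hasSum⟩

theorem hasDerivAt_egf_one {z : ℂ} (hz : ‖z‖ < 1 / 2) :
    Summable (fun n : ℕ => (numCompacted 1 n : ℂ) * z ^ n / (n.factorial : ℂ)) ∧
      HasDerivAt (fun w : ℂ => ∑' n : ℕ, (numCompacted 1 n : ℂ) * w ^ n / (n.factorial : ℂ))
        (Complex.exp (z / 2) / (1 - 2 * z) ^ (5 / 4 : ℂ)) z := by
  -- On the ball of radius `r` the derivatives of the terms are dominated by their norms at `r`,
  -- which are summable because `r < 1 / 2`; this permits termwise differentiation.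
  obtain ⟨r, hzr, hr⟩ := exists_between hz
  have hr0 : 0 < r := (norm_nonneg z).trans_lt hzr
  let g' : ℕ → ℂ → ℂ := fun n w =>
    (numCompacted 1 n : ℂ) * (n * w ^ (n - 1)) / (n.factorial : ℂ)
  have hg' : ∀ n w, g' (n + 1) w = (derivCoeff n : ℂ) * w ^ n := fun n w => by
    have h1 : (n : ℂ) + 1 ≠ 0 := by exact_mod_cast Nat.succ_ne_zero n
    have h3 : (n.factorial : ℂ) ≠ 0 := by exact_mod_cast n.factorial_ne_zero
    simp only [g']
    rw [numCompacted_one_succ_complex, Nat.factorial_succ, Nat.add_sub_cancel]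
    push_cast
    field_simp
  have hu : Summable fun n => ‖g' n r‖ := by
    rw [← summable_nat_add_iff 1]
    simp only [hg']
    exact (hasSum_derivCoeff (z := r) (by
      rwa [Complex.norm_real, Real.norm_of_nonneg hr0.le])).1
  have hg : ∀ n, ∀ w ∈ Metric.ball (0 : ℂ) r, HasDerivAt
      (fun w : ℂ => (numCompacted 1 n : ℂ) * w ^ n / (n.factorial : ℂ)) (g' n w) w :=
    fun n w _ => ((hasDerivAt_pow n w).const_mul _).div_const _
  have hb : ∀ n, ∀ w ∈ Metric.ball (0 : ℂ) r, ‖g' n w‖ ≤ ‖g' n r‖ := fun n w hw => by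
    rw [mem_ball_zero_iff] at hw
    simp only [g', norm_div, norm_mul, norm_pow]
    rw [Complex.norm_real r, Real.norm_of_nonneg hr0.le]
    gcongr
  have hpre : IsPreconnected (Metric.ball (0 : ℂ) r) := (convex_ball _ _).isPreconnected
  have h0 : (0 : ℂ) ∈ Metric.ball (0 : ℂ) r := Metric.mem_ball_self hr0
  have hz0 : z ∈ Metric.ball (0 : ℂ) r := mem_ball_zero_iff.2 hzr
  have hs0 : Summable fun n : ℕ => (numCompacted 1 n : ℂ) * 0 ^ n / (n.factorial : ℂ) :=
    summable_of_ne_finset_zero (s := {0}) fun n hn => by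
      rw [Finset.mem_singleton] at hn
      simp [hn]
  refine ⟨summable_of_summable_hasDerivAt_of_isPreconnected hu Metric.isOpen_ball hpre hg hb h0 hs0
    hz0, ?_⟩
  have h := hasDerivAt_tsum_of_isPreconnected hu Metric.isOpen_ball hpre hg hb h0 hs0 hz0
  have hsum : HasSum (fun n => g' n z) (Complex.exp (z / 2) / (1 - 2 * z) ^ (5 / 4 : ℂ)) := by
    rw [← hasSum_nat_add_iff' 1]
    simp only [hg']
    simpa [g'] using (hasSum_derivCoeff hz).2
  rwa [hsum.tsum_eq] at h

/-! ### Asymptotics by two-sided estimates -/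

theorem derivCoeff_eq (n : ℕ) :
    derivCoeff n = 2 ^ n * ∑ k ∈ Finset.range (n + 1),
      (1 / 4) ^ k / (k.factorial : ℝ) * binomCoeff (n - k) := by
  rw [derivCoeff, Finset.Nat.sum_antidiagonal_eq_sum_range_succ
    (fun i j => ((1 / 2) ^ i / (i.factorial : ℝ)) * (2 ^ j * binomCoeff j)), Finset.mul_sum]
  refine Finset.sum_congr rfl fun k hk => ?_
  obtain ⟨m, rfl⟩ := Nat.exists_eq_add_of_le (Nat.lt_succ_iff.1 (Finset.mem_range.1 hk))
  rw [Nat.add_sub_cancel_left, pow_add, show (1 / 4 : ℝ) = 1 / 2 * (1 / 2) by norm_num, mul_pow]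
  have : (1 / 2 : ℝ) ^ k * 2 ^ k = 1 := by rw [← mul_pow]; norm_num
  linear_combination (-(1 / 2) ^ k / (k.factorial : ℝ) * 2 ^ m * binomCoeff m) * this

theorem hasSum_exp_div_factorial (x : ℝ) :
    HasSum (fun k : ℕ => x ^ k / (k.factorial : ℝ)) (Real.exp x) := by
  rw [Real.exp_eq_exp_ℝ]
  exact NormedSpace.expSeries_div_hasSum_exp x

theorem hasSum_mul_exp_div_factorial (x : ℝ) :
    HasSum (fun k : ℕ => k * (x ^ k / (k.factorial : ℝ))) (x * Real.exp x) := by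
  rw [← hasSum_nat_add_iff' 1]
  simp only [Finset.sum_range_one, Nat.cast_zero, zero_mul, sub_zero]
  convert! (hasSum_exp_div_factorial x).mul_left x using 2 with k
  rw [Nat.factorial_succ, pow_succ]
  push_cast
  field_simp

theorem derivCoeff_le (n : ℕ) : derivCoeff n ≤ 2 ^ n * (binomCoeff n * Real.exp (1 / 4)) := by
  rw [derivCoeff_eq]
  gcongr
  have hb := binomCoeff_pos n
  calc _ ≤ ∑ k ∈ Finset.range (n + 1), (1 / 4) ^ k / (k.factorial : ℝ) * binomCoeff n := by
        gcongr with k hk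
        exact binomCoeff_monotone (Nat.sub_le _ _)
    _ = binomCoeff n * ∑ k ∈ Finset.range (n + 1), (1 / 4) ^ k / (k.factorial : ℝ) := by
        rw [← Finset.sum_mul, mul_comm]
    _ ≤ _ := by
        gcongr
        exact sum_le_hasSum _ (fun k _ => by positivity) (hasSum_exp_div_factorial _)

/-- As `binomCoeff m / (m + 1)` decreases, `binomCoeff (n - k)` is at least `binomCoeff n * (1 - k /
(n + 1))`. Summed over all `k`, these weights give `exp (1 / 4) * (1 - (1 / 4) / (n + 1))`, and the
terms with `k > n` are nonpositive, so dropping them only increases the sum. -/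
theorem le_derivCoeff (n : ℕ) :
    2 ^ n * (binomCoeff n * (Real.exp (1 / 4) * (1 - 1 / (n + 1)))) ≤ derivCoeff n := by
  rw [derivCoeff_eq]
  gcongr
  have hb := binomCoeff_pos n
  have hs := (hasSum_exp_div_factorial (1 / 4)).sub
    ((hasSum_mul_exp_div_factorial (1 / 4)).mul_left (1 / ((n : ℝ) + 1)))
  have hle := sum_le_hasSum (Finset.range (n + 1)) (fun k hk => ?_) hs.neg
  · rw [Finset.sum_neg_distrib, neg_le_neg_iff] at hle
    calc _ ≤ binomCoeff n * (Real.exp (1 / 4) - 1 / (n + 1) * (1 / 4 * Real.exp (1 / 4))) := by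
          gcongr
          have : 0 ≤ 1 / ((n : ℝ) + 1) * Real.exp (1 / 4) := by positivity
          linarith
      _ ≤ binomCoeff n * _ := mul_le_mul_of_nonneg_left hle hb.le
      _ ≤ _ := by
          rw [Finset.mul_sum]
          refine Finset.sum_le_sum fun k hk => ?_
          obtain ⟨m, rfl⟩ := Nat.exists_eq_add_of_le (Nat.lt_succ_iff.1 (Finset.mem_range.1 hk))
          have h := binomCoeff_div_antitone (Nat.le_add_left m k)
          simp only at h
          rw [div_le_iff₀ (by positivity)] at h
          rw [Nat.add_sub_cancel_left]
          calc _ = (1 / 4) ^ k / (k.factorial : ℝ) *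
                (binomCoeff (k + m) / (((k + m : ℕ) : ℝ) + 1) * (m + 1)) := by
                push_cast; field_simp; ring
            _ ≤ _ := by
                gcongr
                rw [div_mul_eq_mul_div, div_le_iff₀ (by positivity)]
                calc binomCoeff (k + m) * (m + 1) ≤ _ := mul_le_mul_of_nonneg_right h (by positivity)
                  _ = _ := by field_simp
  · rw [Finset.mem_range, not_lt] at hk
    have hk' : (n : ℝ) + 1 ≤ k := by exact_mod_cast hk
    have h1 : 1 ≤ 1 / ((n : ℝ) + 1) * k := by
      rw [one_div_mul_eq_div, le_div_iff₀ (by positivity)]; linarith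
    have h2 : 0 ≤ (1 / 4 : ℝ) ^ k / (k.factorial : ℝ) := by positivity
    nlinarith

/-- The quotient of `numCompacted 1 (m + 1)` and its asymptotic value. -/
noncomputable def asymptoticRatio (m : ℕ) : ℝ :=
  derivCoeff m * Real.Gamma (5 / 4) / (2 ^ m * Real.exp (1 / 4) * ((m : ℝ) + 1) ^ (1 / 4 : ℝ))

theorem numCompacted_one_eq_mul_asymptoticRatio (m : ℕ) :
    (numCompacted 1 (m + 1) : ℝ) = Real.exp (1 / 4) / Real.Gamma (1 / 4) *
      (((m + 1).factorial : ℝ) * 2 ^ (m + 1 + 1) / ((m + 1 : ℕ) : ℝ) ^ (3 / 4 : ℝ)) *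
        asymptoticRatio m := by
  have hG : Real.Gamma (5 / 4) = 1 / 4 * Real.Gamma (1 / 4) := by
    rw [← Real.Gamma_add_one (by norm_num)]; norm_num
  have hG0 : Real.Gamma (1 / 4) ≠ 0 := (Real.Gamma_pos_of_pos (by norm_num)).ne'
  have hp : ((m : ℝ) + 1) ^ (3 / 4 : ℝ) * ((m : ℝ) + 1) ^ (1 / 4 : ℝ) = m + 1 := by
    rw [← Real.rpow_add (by positivity)]; norm_num
  have h1 : ((m : ℝ) + 1) ^ (3 / 4 : ℝ) ≠ 0 := by positivity
  have h2 : ((m : ℝ) + 1) ^ (1 / 4 : ℝ) ≠ 0 := by positivity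
  rw [numCompacted_one_succ, asymptoticRatio, hG, Nat.factorial_succ]
  push_cast
  generalize ((m : ℝ) + 1) ^ (3 / 4 : ℝ) = u at *
  generalize ((m : ℝ) + 1) ^ (1 / 4 : ℝ) = v at *
  rw [← hp]
  have := Real.exp_ne_zero (1 / 4)
  field_simp
  ring

theorem asymptoticRatio_le_one (m : ℕ) : asymptoticRatio m ≤ 1 := by
  have hG := Gamma_five_fourths_pos
  rw [asymptoticRatio, div_le_one (by positivity)]
  have h1 := Gamma_nat_add_le m
  calc derivCoeff m * Real.Gamma (5 / 4)
      ≤ 2 ^ m * (binomCoeff m * Real.exp (1 / 4)) * Real.Gamma (5 / 4) := by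
        gcongr; exact derivCoeff_le m
    _ = 2 ^ m * Real.exp (1 / 4) * (Real.Gamma (m + 5 / 4) / m.factorial) := by
        rw [binomCoeff]; field_simp
    _ ≤ _ := by
        gcongr
        rw [div_le_iff₀ (by positivity)]
        exact h1

theorem one_sub_le_asymptoticRatio (m : ℕ) : 1 - 2 / ((m : ℝ) + 1) ≤ asymptoticRatio m := by
  have hG := Gamma_five_fourths_pos
  have h1 := le_Gamma_nat_add m
  have hm : (0 : ℝ) < m + 1 := by positivity
  have h0 : 0 ≤ 1 - 1 / ((m : ℝ) + 1) := by
    rw [sub_nonneg, div_le_one hm]; linarith [(Nat.cast_nonneg m : (0 : ℝ) ≤ m)]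
  -- This is `t ≤ t ^ (1 / 4)` for `t = 1 - 1 / (m + 1)` in `[0, 1]`.
  have h2 : ((m : ℝ) + 1) ^ (1 / 4 : ℝ) * (1 - 1 / (m + 1)) ≤ (m : ℝ) ^ (1 / 4 : ℝ) := by
    have e : (m : ℝ) = (m + 1) * (1 - 1 / (m + 1)) := by field_simp; ring
    conv_rhs => rw [e]
    rw [Real.mul_rpow hm.le h0]
    gcongr
    refine Real.self_le_rpow_of_le_one h0 ?_ (by norm_num)
    have : 0 ≤ 1 / ((m : ℝ) + 1) := by positivity
    linarith
  rw [asymptoticRatio, le_div_iff₀ (by positivity)]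
  calc (1 - 2 / ((m : ℝ) + 1)) * (2 ^ m * Real.exp (1 / 4) * ((m : ℝ) + 1) ^ (1 / 4 : ℝ))
      ≤ ((1 - 1 / ((m : ℝ) + 1)) * (1 - 1 / (m + 1))) *
          (2 ^ m * Real.exp (1 / 4) * ((m : ℝ) + 1) ^ (1 / 4 : ℝ)) := by
        gcongr
        have : 0 ≤ (1 / ((m : ℝ) + 1)) ^ 2 := by positivity
        have e : 2 / ((m : ℝ) + 1) = 2 * (1 / (m + 1)) := by ring
        rw [e]
        nlinarith
    _ = 2 ^ m * (Real.exp (1 / 4) * (1 - 1 / (m + 1))) *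
          (((m : ℝ) + 1) ^ (1 / 4 : ℝ) * (1 - 1 / (m + 1))) := by ring
    _ ≤ 2 ^ m * (Real.exp (1 / 4) * (1 - 1 / (m + 1))) * (m : ℝ) ^ (1 / 4 : ℝ) := by gcongr
    _ ≤ 2 ^ m * (Real.exp (1 / 4) * (1 - 1 / (m + 1))) *
          (Real.Gamma (m + 5 / 4) / m.factorial) := by
        gcongr
        rwa [le_div_iff₀ (by positivity)]
    _ = 2 ^ m * (binomCoeff m * (Real.exp (1 / 4) * (1 - 1 / (m + 1)))) * Real.Gamma (5 / 4) := by
        rw [binomCoeff]; field_simp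
    _ ≤ _ := by gcongr; exact le_derivCoeff m

end CompactedTrees
theorem theorem8p3 :
    -- the formal generating function is D-finite and satisfies the differential equation
    CompactedTrees.IsDFinite (CompactedTrees.egf 1) ∧
    (1 - 2 * PowerSeries.X) *
        PowerSeries.derivative ℂ (PowerSeries.derivative ℂ (CompactedTrees.egf 1))
      - (3 - PowerSeries.X) * PowerSeries.derivative ℂ (CompactedTrees.egf 1) = 0 ∧
    PowerSeries.constantCoeff (CompactedTrees.egf 1) = 1 ∧
    PowerSeries.constantCoeff (PowerSeries.derivative ℂ (CompactedTrees.egf 1)) = 1 ∧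
    -- it converges for |z| < 1/2, and its sum has the derivative given by the closed form
    (∀ z : ℂ, ‖z‖ < 1 / 2 →
      Summable (fun n : ℕ =>
        (CompactedTrees.numCompacted 1 n : ℂ) * z ^ n / (n.factorial : ℂ)) ∧
      HasDerivAt
        (fun w : ℂ => ∑' n : ℕ,
          (CompactedTrees.numCompacted 1 n : ℂ) * w ^ n / (n.factorial : ℂ))
        (Complex.exp (z / 2) / (1 - 2 * z) ^ (5 / 4 : ℂ)) z) ∧
    -- asymptotics of the number of trees
    ∃ ε : ℕ → ℝ, Asymptotics.IsBigO Filter.atTop ε (fun n : ℕ => 1 / (n : ℝ)) ∧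
      ∀ n : ℕ, 1 ≤ n →
        (CompactedTrees.numCompacted 1 n : ℝ) =
          Real.exp (1 / 4) / Real.Gamma (1 / 4) *
            ((n.factorial : ℝ) * 2 ^ (n + 1) / (n : ℝ) ^ (3 / 4 : ℝ)) * (1 + ε n) := by
  refine ⟨CompactedTrees.isDFinite_egf_one, CompactedTrees.egf_one_ode,
    CompactedTrees.constantCoeff_egf_one, CompactedTrees.constantCoeff_derivative_egf_one,
    fun z hz => CompactedTrees.hasDerivAt_egf_one hz,
    -- `asymptoticRatio m` belongs to size `m + 1`, hence the shift; the value at `n = 0` plays no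
    -- role.
    fun n => CompactedTrees.asymptoticRatio (n - 1) - 1, ?_, fun n hn => ?_⟩
  · refine Asymptotics.IsBigO.of_bound 2 ?_
    filter_upwards [Filter.eventually_ge_atTop 1] with n hn
    obtain ⟨m, rfl⟩ := Nat.exists_eq_add_of_le' hn
    have h1 := CompactedTrees.asymptoticRatio_le_one m
    have h2 := CompactedTrees.one_sub_le_asymptoticRatio m
    rw [Nat.add_sub_cancel, Real.norm_of_nonpos (by linarith), Real.norm_of_nonneg (by positivity),
      mul_one_div]
    push_cast
    linarith
  · obtain ⟨m, rfl⟩ := Nat.exists_eq_add_of_le' hn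
    dsimp only
    rw [Nat.add_sub_cancel, add_sub_cancel]
    exact CompactedTrees.numCompacted_one_eq_mul_asymptoticRatio m
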